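/- Let $D\ge 1$, let $s=m_0,m_1,\dots,m_{D-1},m_D=t$ be positive integers, let $\sigma:\mathbb R\to\mathbb R$ be continuous, and let $\Theta=\prod_{j=1}^D(\mathbb R^{m_j\times m_{j-1}}\times\mathbb R^{m_j})$. For $x\in\mathbb R^s$ and $\theta=(W_j,b_j)_{j=1}^D\in\Theta$ let $\mathcal N(x,\theta)=\mathcal N^D(x)\in\mathbb R^t$ be the deep neural network given by $\mathcal N^1(x)=W_1x+b_1$ and $\mathcal N^{j+1}(x)=W_{j+1}\sigma(\mathcal N^j(x))+b_{j+1}$, where $\sigma$ acts componentwise. Let $\rho:\Theta\to(0,\infty)$ be continuous, and suppose that for all $x\in\mathbb R^s$ and $1\le k\le t$ the function $\mathcal N_k(x,\cdot)\rho(\cdot)$ belongs to $C_0(\Theta)$, the space of continuous real functions on $\Theta$ vanishing at infinity, with the supremum norm. Put $\mathcal K(x,\theta)=\mathcal N(x,\theta)\rho(\theta)$. Let $\mathcal M(\Theta)$ be the space of finite signed Radon measures on $\Theta$ with the total variation norm. For $\mu\in\mathcal M(\Theta)$ define $f_\mu:\mathbb R^s\to\mathbb R^t$ by $f_\mu^k(x)=\int_\Theta\mathcal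 N_k(x,\theta)\rho(\theta)\,d\mu(\theta)$, and let $\mathcal B_{\mathcal N}=\{f_\mu:\mu\in\mathcal M(\Theta)\}$ with the norm $\|f_\mu\|=\inf\{\|\nu\|_{\mathrm{TV}}: f_\nu=f_\mu\}$. Let $\mathcal S$ be the closed linear span in $C_0(\Theta)$ of the functions $\mathcal K_k(x,\cdot)$, $x\in\mathbb R^s$, $1\le k\le t$. Let $\mathcal B_{\mathcal N}'$ (the $\delta$-dual space) be the norm closure, in the dual space $\mathcal B_{\mathcal N}^*$, of the linear span of the point evaluation functionals $\delta_{x,k}:f\mapsto f^k(x)$. Then $\mathcal B_{\mathcal N}$ is a vector-valued reproducing kernel Banach space, that is, a Banach space of functions from $\mathbb R^s$ to $\mathbb R^t$ with continuous point evaluations, and $\mathcal K$ is its reproducing kernel in the following sense. There is a linear isometric isomorphism $\kappa$ from $\mathcal B_{\mathcal N}'$ onto $\mathcal S$ such that the bilinear form $\langle g,f\rangle:=(\kappa^{-1}g)(f)$ on $\mathcal S\times\mathcal B_{\mathcal N}$ satisfies $\langle g,f_\mu\rangle=\int_\Theta g\,d\mu$ for all $g\in\mathcal S$, $\mu\in\mathcal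 M(\Theta)$, and moreover: (i) $\mathcal K_k(x,\cdot)\in\mathcal S$ for all $x\in\mathbb R^s$, $1\le k\le t$; (ii) $f_\mu^k(x)=\langle\mathcal K_k(x,\cdot),f_\mu\rangle$ for all $f_\mu\in\mathcal B_{\mathcal N}$, $x\in\mathbb R^s$, $1\le k\le t$; (iii) $\mathcal K$ is the only function $\mathbb R^s\times\Theta\to\mathbb R^t$ with properties (i) and (ii) for this $\kappa$. -/

import Mathlib

open MeasureTheory Filter Topology
open scoped ZeroAtInfty

noncomputable section

namespace DeepRKBS

/-! ### Deep neural networks -/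

/-- The parameter space `Θ` of the fully connected networks of depth `D = L + 1` (that is, with `L`
hidden layers) and layer widths `m 0, m 1, …, m (L + 1)`, where `m 0` is the input dimension and
`m (L + 1)` the output dimension. A parameter `θ` consists of the weight matrix
`(θ j).1 ∈ ℝ^{m (j+1) × m j}` and the bias vector `(θ j).2 ∈ ℝ^{m (j+1)}` for `j = 0, …, L`.
The values of `m` beyond `L + 1` play no role. -/
def ParamSpace (L : ℕ) (m : ℕ → ℕ) : Type :=
  (j : Fin (L + 1)) → Matrix (Fin (m (j + 1))) (Fin (m j)) ℝ × (Fin (m (j + 1)) → ℝ)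

/-- The usual (product, i.e. Euclidean) topology. -/
instance (L : ℕ) (m : ℕ → ℕ) : TopologicalSpace (ParamSpace L m) :=
  inferInstanceAs (TopologicalSpace ((j : Fin (L + 1)) →
    Matrix (Fin (m (j + 1))) (Fin (m j)) ℝ × (Fin (m (j + 1)) → ℝ)))

/-- The Borel σ-algebra. -/
instance (L : ℕ) (m : ℕ → ℕ) : MeasurableSpace (ParamSpace L m) := borel _

instance (L : ℕ) (m : ℕ → ℕ) : BorelSpace (ParamSpace L m) := ⟨rfl⟩

/-- `layer σ x θ j` is the output of the `(j+1)`-st affine layer: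
`𝒩¹(x) = W₁ x + b₁` and `𝒩^{j+1}(x) = W_{j+1} σ(𝒩^j(x)) + b_{j+1}`, with the activation function
`σ` applied componentwise. -/
def layer {L : ℕ} {m : ℕ → ℕ} (σ : ℝ → ℝ) (x : Fin (m 0) → ℝ) (θ : ParamSpace L m) :
    (j : ℕ) → j < L + 1 → Fin (m (j + 1)) → ℝ
  | 0, hj => Matrix.mulVec (θ ⟨0, hj⟩).1 x + (θ ⟨0, hj⟩).2
  | j + 1, hj =>
      Matrix.mulVec (θ ⟨j + 1, hj⟩).1 (fun i => σ (layer σ x θ j (Nat.lt_of_succ_lt hj) i))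
        + (θ ⟨j + 1, hj⟩).2

/-- The deep neural network `𝒩(x, θ)` of depth `L + 1`. -/
def net {L : ℕ} {m : ℕ → ℕ} (σ : ℝ → ℝ) (x : Fin (m 0) → ℝ) (θ : ParamSpace L m) :
    Fin (m (L + 1)) → ℝ :=
  layer σ x θ L (Nat.lt_succ_self L)

/-- The kernel `𝒦(x, θ) = 𝒩(x, θ) ρ(θ)`. -/
def netKernel {L : ℕ} {m : ℕ → ℕ} (σ : ℝ → ℝ) (ρ : ParamSpace L m → ℝ) :
    (Fin (m 0) → ℝ) → ParamSpace L m → Fin (m (L + 1)) → ℝ :=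
  fun x θ k => net σ x θ k * ρ θ

/-- `f` belongs to `C₀(Θ)`: it is continuous and vanishes at infinity. -/
def MemC0 {Θ : Type*} [TopologicalSpace Θ] (f : Θ → ℝ) : Prop :=
  Continuous f ∧ Tendsto f (cocompact Θ) (𝓝 0)

/-- The functions `𝒩_k(x, ·) ρ(·)`, as elements of the Banach space `C₀(Θ)`. -/
def netSection {L : ℕ} {m : ℕ → ℕ} (σ : ℝ → ℝ) (ρ : ParamSpace L m → ℝ)
    (h : ∀ x k, MemC0 fun θ => netKernel σ ρ x θ k) (x : Fin (m 0) → ℝ) (k : Fin (m (L + 1))) :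
    C₀(ParamSpace L m, ℝ) where
  toFun θ := netKernel σ ρ x θ k
  continuous_toFun := (h x k).1
  zero_at_infty' := (h x k).2

/-! ### Finite signed Radon measures

On the parameter space every finite signed Borel measure is Radon (see `regular_variation` below),
so that the space `ℳ(Θ)` of finite signed Radon measures is `SignedMeasure Θ`. The measure
`μ.variation = |μ|` is the supremum of `∑ |μ(E_k)|` over measurable partitions, and `∫ᵛ θ, g θ ∂•μ`
is the integral of `g` against the signed measure `μ`. -/

section Measures

variable {Θ : Type*} [MeasurableSpace Θ]

instance isFiniteMeasure_variation (μ : SignedMeasure Θ) : IsFiniteMeasure μ.variation := by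
  rw [← SignedMeasure.totalVariation_eq_variation]
  unfold SignedMeasure.totalVariation
  infer_instance

theorem regular_variation {L : ℕ} {m : ℕ → ℕ} (μ : SignedMeasure (ParamSpace L m)) :
    μ.variation.Regular := by
  have h2 : SigmaCompactSpace (ParamSpace L m) :=
    inferInstanceAs (SigmaCompactSpace ((j : Fin (L + 1)) →
      (Fin (m (j + 1)) → Fin (m j) → ℝ) × (Fin (m (j + 1)) → ℝ)))
  have h3 : TopologicalSpace.MetrizableSpace (ParamSpace L m) :=
    inferInstanceAs (TopologicalSpace.MetrizableSpace ((j : Fin (L + 1)) →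
      (Fin (m (j + 1)) → Fin (m j) → ℝ) × (Fin (m (j + 1)) → ℝ)))
  let _ := TopologicalSpace.pseudoMetrizableSpacePseudoMetric (ParamSpace L m)
  infer_instance

/-- The total variation norm `‖μ‖_TV = |μ|(Θ)`. -/
def tvNorm (μ : SignedMeasure Θ) : ℝ := μ.variation.real Set.univ

theorem tvNorm_nonneg (μ : SignedMeasure Θ) : 0 ≤ tvNorm μ := measureReal_nonneg

theorem tvNorm_add_le (μ ν : SignedMeasure Θ) : tvNorm (μ + ν) ≤ tvNorm μ + tvNorm ν := by
  unfold tvNorm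
  rw [← measureReal_add_apply]
  exact ENNReal.toReal_mono (measure_ne_top _ _) (VectorMeasure.variation_add_le _)

theorem tvNorm_smul (c : ℝ) (μ : SignedMeasure Θ) : tvNorm (c • μ) = |c| * tvNorm μ := by
  unfold tvNorm
  rw [VectorMeasure.variation_smul]
  simp [Measure.real]

theorem abs_integral_le [TopologicalSpace Θ] (μ : SignedMeasure Θ) (g : C₀(Θ, ℝ)) :
    |∫ᵛ θ, g θ ∂•μ| ≤ ‖g‖ * tvNorm μ := by
  have h := VectorMeasure.norm_integral_le_of_norm_le_const (μ := μ) (f := g)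
    (B := ContinuousLinearMap.lsmul ℝ ℝ) (C := ‖g‖)
    (Eventually.of_forall fun θ => g.toBCF.norm_coe_le_norm θ)
  simpa [tvNorm] using h

variable [TopologicalSpace Θ] [BorelSpace Θ]

theorem integrable_of_c0 (μ : SignedMeasure Θ) (g : C₀(Θ, ℝ)) : μ.Integrable g :=
  Integrable.of_bound g.continuous.measurable.aestronglyMeasurable ‖g‖
    (Eventually.of_forall fun θ => g.toBCF.norm_coe_le_norm θ)

/-! ### The Banach space `ℬ` of the functions `f_μ` and its pre-dual

The construction is carried out for a family `Φ x k` of elements of `C₀(Θ)`; it is applied to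
`Φ x k = 𝒩_k(x, ·) ρ(·)`. -/

variable {X : Type*} {n : ℕ}

/-- The linear map `μ ↦ f_μ`, where `f_μ^k(x) = ∫ Φ x k dμ`. -/
def integralMap (Φ : X → Fin n → C₀(Θ, ℝ)) : SignedMeasure Θ →ₗ[ℝ] (X → Fin n → ℝ) where
  toFun μ := fun x k => ∫ᵛ θ, Φ x k θ ∂•μ
  map_add' μ ν := by
    funext x k
    exact VectorMeasure.integral_add_vectorMeasure (integrable_of_c0 μ _) (integrable_of_c0 ν _)
  map_smul' c μ := by
    funext x k
    exact VectorMeasure.integral_smul_vectorMeasure _ c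

/-- The vector space `{f_μ : μ ∈ ℳ(Θ)}` of functions from `X` to `ℝⁿ`. -/
def IntegralSpace (Φ : X → Fin n → C₀(Θ, ℝ)) : Type _ := ↥(LinearMap.range (integralMap Φ))

namespace IntegralSpace

variable (Φ : X → Fin n → C₀(Θ, ℝ))

instance : AddCommGroup (IntegralSpace Φ) :=
  inferInstanceAs (AddCommGroup ↥(LinearMap.range (integralMap Φ)))

instance : Module ℝ (IntegralSpace Φ) :=
  inferInstanceAs (Module ℝ ↥(LinearMap.range (integralMap Φ)))

/-- An element of the space, as a function from `X` to `ℝⁿ`. -/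
def toFun : IntegralSpace Φ →ₗ[ℝ] (X → Fin n → ℝ) :=
  (LinearMap.range (integralMap Φ)).subtype

/-- The element `f_μ` of the space. -/
def mk (μ : SignedMeasure Θ) : IntegralSpace Φ := ⟨integralMap Φ μ, μ, rfl⟩

/-- The norm `‖f‖ = inf {‖ν‖_TV : f_ν = f}`. -/
instance : Norm (IntegralSpace Φ) :=
  ⟨fun f => sInf {r | ∃ ν : SignedMeasure Θ, mk Φ ν = f ∧ r = tvNorm ν}⟩

variable {Φ}

theorem exists_mk (f : IntegralSpace Φ) : ∃ μ, mk Φ μ = f := by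
  obtain ⟨_, μ, rfl⟩ := f
  exact ⟨μ, rfl⟩

theorem norm_mk_le (ν : SignedMeasure Θ) : ‖mk Φ ν‖ ≤ tvNorm ν :=
  csInf_le ⟨0, by rintro _ ⟨ν, -, rfl⟩; exact tvNorm_nonneg ν⟩ ⟨ν, rfl, rfl⟩

theorem le_norm {f : IntegralSpace Φ} {b : ℝ} (h : ∀ ν, mk Φ ν = f → b ≤ tvNorm ν) : b ≤ ‖f‖ := by
  obtain ⟨μ, hμ⟩ := exists_mk f
  exact le_csInf ⟨_, μ, hμ, rfl⟩ (by rintro _ ⟨ν, hν, rfl⟩; exact h ν hν)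

theorem mk_add (μ ν : SignedMeasure Θ) : mk Φ (μ + ν) = mk Φ μ + mk Φ ν :=
  Subtype.ext (map_add (integralMap Φ) μ ν)

theorem mk_smul (c : ℝ) (μ : SignedMeasure Θ) : mk Φ (c • μ) = c • mk Φ μ :=
  Subtype.ext (map_smul (integralMap Φ) c μ)

theorem norm_smul_le' (c : ℝ) (f : IntegralSpace Φ) : ‖c • f‖ ≤ |c| * ‖f‖ := by
  rcases eq_or_ne c 0 with rfl | hc
  · have h := norm_mk_le (Φ := Φ) 0
    have h0 := tvNorm_smul 0 (0 : SignedMeasure Θ)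
    have h1 := mk_smul (Φ := Φ) 0 0
    simp only [zero_smul, abs_zero, zero_mul] at h0 h1 ⊢
    rwa [h0, h1] at h
  · have hc' : 0 < |c| := abs_pos.mpr hc
    rw [← div_le_iff₀' hc']
    refine le_norm fun ν hν => ?_
    rw [div_le_iff₀' hc', ← tvNorm_smul, ← hν, ← mk_smul]
    exact norm_mk_le _

theorem abs_toFun_le (f : IntegralSpace Φ) (x : X) (k : Fin n) :
    |toFun Φ f x k| ≤ ‖Φ x k‖ * ‖f‖ := by
  rcases (norm_nonneg (Φ x k)).eq_or_lt with h0 | hpos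
  · obtain ⟨ν, rfl⟩ := exists_mk f
    have h := abs_integral_le ν (Φ x k)
    rw [← h0, zero_mul] at h ⊢
    exact h
  · rw [← div_le_iff₀' hpos]
    refine le_norm fun ν hν => ?_
    rw [div_le_iff₀' hpos, ← hν]
    exact abs_integral_le ν (Φ x k)

theorem core : NormedSpace.Core ℝ (IntegralSpace Φ) where
  norm_nonneg f := le_norm fun ν _ => tvNorm_nonneg ν
  norm_smul c f := by
    refine le_antisymm (norm_smul_le' c f) ?_
    rcases eq_or_ne c 0 with rfl | hc
    · simpa using le_norm (f := (0 : ℝ) • f) fun ν _ => tvNorm_nonneg ν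
    · have h := norm_smul_le' c⁻¹ (c • f)
      rw [smul_smul, inv_mul_cancel₀ hc, one_smul, abs_inv] at h
      rwa [← div_eq_inv_mul, le_div_iff₀' (abs_pos.mpr hc)] at h
  norm_triangle f g := by
    rw [← sub_le_iff_le_add]
    refine le_norm fun ν hν => ?_
    rw [sub_le_comm]
    refine le_norm fun μ hμ => ?_
    rw [sub_le_iff_le_add, ← hν, ← hμ, ← mk_add, add_comm (tvNorm μ)]
    exact (norm_mk_le _).trans (tvNorm_add_le _ _)
  norm_eq_zero_iff f := by
    constructor
    · intro h
      refine Subtype.ext (funext fun x => funext fun k => ?_)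
      have h1 := abs_toFun_le f x k
      rw [h, mul_zero] at h1
      exact abs_nonpos_iff.mp h1
    · rintro rfl
      refine le_antisymm ?_ (le_norm fun ν _ => tvNorm_nonneg ν)
      simpa using norm_smul_le' 0 (0 : IntegralSpace Φ)

instance : NormedAddCommGroup (IntegralSpace Φ) := NormedAddCommGroup.ofCore core

instance : NormedSpace ℝ (IntegralSpace Φ) := NormedSpace.ofCore core

end IntegralSpace

/-- The closed subspace `𝒮` of `C₀(Θ)` spanned by the functions `Φ x k`, with the supremum norm. -/
def closedSpan (Φ : X → Fin n → C₀(Θ, ℝ)) : Submodule ℝ C₀(Θ, ℝ) :=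
  (Submodule.span ℝ (Set.range fun p : X × Fin n => Φ p.1 p.2)).topologicalClosure

/-- An element of `𝒮`, as a function on `Θ`. -/
def closedSpanToFun (Φ : X → Fin n → C₀(Θ, ℝ)) : closedSpan Φ →ₗ[ℝ] (Θ → ℝ) where
  toFun g := g.1
  map_add' _ _ := rfl
  map_smul' _ _ := rfl

end Measures

/-! ### Vector-valued reproducing kernel Banach spaces

A normed space of functions from `X` to `ℝⁿ` is given by a normed space `B` together with the linear
map `ev` that regards an element of `B` as a function. -/

section RKBS

variable {X X' : Type*} {n : ℕ} {B S : Type*} [NormedAddCommGroup B] [NormedSpace ℝ B]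
  [NormedAddCommGroup S] [NormedSpace ℝ S]

/-- `B` is a vector-valued reproducing kernel Banach space: a Banach space of functions from `X` to
`ℝⁿ` all of whose point evaluations are continuous. -/
structure IsVectorRKBS (ev : B →ₗ[ℝ] (X → Fin n → ℝ)) : Prop where
  complete : CompleteSpace B
  injective : Function.Injective ev
  bounded_eval : ∀ x, ∃ C > 0, ∀ f, ‖ev f x‖ ≤ C * ‖f‖

/-- The `δ`-dual space of `B`: the norm closure, in the dual space of `B`, of the linear span of the
componentwise point evaluation functionals `δ_{x,k} : f ↦ f_k(x)`. -/
def deltaDual (ev : B →ₗ[ℝ] (X → Fin n → ℝ)) : Submodule ℝ (StrongDual ℝ B) :=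
  (Submodule.span ℝ {ℓ | ∃ x k, ∀ f, ℓ f = ev f x k}).topologicalClosure

/-- The bilinear form `⟨g, f⟩ = ⟨κ⁻¹ g, f⟩_B` on `S × B` induced by an isometric isomorphism `κ` from
the `δ`-dual space of `B` onto `S`. -/
def dualForm {ev : B →ₗ[ℝ] (X → Fin n → ℝ)} (κ : deltaDual ev ≃ₗᵢ[ℝ] S) (g : S) (f : B) : ℝ :=
  (κ.symm g : StrongDual ℝ B) f

/-- `K` is a reproducing kernel of `B`, with respect to the normed space `S` of functions on `X'`
(an element of `S` is regarded as a function through `evS`) and the isometric isomorphism `κ` of the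
`δ`-dual space of `B` with `S`. -/
structure IsReproducingKernel (ev : B →ₗ[ℝ] (X → Fin n → ℝ)) (S : Type*)
    [NormedAddCommGroup S] [NormedSpace ℝ S] (evS : S →ₗ[ℝ] (X' → ℝ))
    (κ : deltaDual ev ≃ₗᵢ[ℝ] S) (K : X → X' → Fin n → ℝ) : Prop where
  /-- `K_k(x, ·)` belongs to `S`. -/
  mem : ∀ x k, ∃ g : S, evS g = fun x' => K x x' k
  /-- The reproducing property `f_k(x) = ⟨K_k(x, ·), f⟩`. -/
  reproducing : ∀ x k (g : S), (evS g = fun x' => K x x' k) → ∀ f : B, ev f x k = dualForm κ g f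

end RKBS

end DeepRKBS

end

open MeasureTheory Filter Topology
open scoped ZeroAtInfty

noncomputable section

namespace DeepRKBS

/-! ### Absolutely convergent series of signed measures, and completeness of the function space. -/

section Completeness

variable {Θ : Type*} [MeasurableSpace Θ]

/-! The network structure plays no role: everything holds for an arbitrary family `Φ x k` in
`C₀(Θ)`. The space of the `f_μ` is the quotient of the signed measures, in total variation norm, by
those that annihilate every `Φ x k`, with the quotient norm. Completeness is inherited from the
measures: terms of an absolutely convergent series lift to measures with summable norms, and these
can be summed setwise (`sumMeasure`).

A measure annihilating the generators annihilates their closed span, so `f_μ ↦ ∫ g dμ` is well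
defined for `g` in that span (`integral_eq_of_mk_eq`). This embeds the span into the dual space,
isometrically because Dirac measures already recover the sup norm (`norm_dualFunctional`); neither
Riesz representation nor Hahn–Banach is needed. Generators go to point evaluations, and the image of
a complete space under an isometry is closed, so the image is the `δ`-dual (`range_dualEmbedding`).
The inverse of this embedding is `κ`, and the reproducing property is the image of a generator read
off. Uniqueness holds because `κ⁻¹` is injective. -/

theorem ofReal_tvNorm (μ : SignedMeasure Θ) :
    ENNReal.ofReal (tvNorm μ) = μ.variation Set.univ :=
  ofReal_measureReal

theorem enorm_apply_le_variation_univ (μ : SignedMeasure Θ) (s : Set Θ) :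
    ‖μ s‖ₑ ≤ μ.variation Set.univ :=
  (VectorMeasure.enorm_measure_le_variation μ s).trans (measure_mono (Set.subset_univ s))

theorem abs_apply_le_tvNorm (μ : SignedMeasure Θ) (s : Set Θ) : |μ s| ≤ tvNorm μ := by
  rw [← ENNReal.ofReal_le_ofReal_iff (tvNorm_nonneg μ), ofReal_tvNorm, ← Real.enorm_eq_ofReal_abs]
  exact enorm_apply_le_variation_univ μ s

theorem tsum_variation_univ_ne_top {μ : ℕ → SignedMeasure Θ} (hμ : Summable fun n => tvNorm (μ n)) :
    ∑' n, (μ n).variation Set.univ ≠ ⊤ := by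
  simp_rw [← ofReal_tvNorm]
  exact hμ.tsum_ofReal_ne_top

/-- A series of signed measures whose total variation norms are summable converges setwise to a
signed measure. -/
def sumMeasure (μ : ℕ → SignedMeasure Θ) (hμ : Summable fun n => tvNorm (μ n)) :
    SignedMeasure Θ where
  measureOf' s := ∑' n, μ n s
  empty' := by simp
  not_measurable' s hs := by simp [(μ _).not_measurable hs]
  m_iUnion' f hf hd := by
    -- Countable additivity is an exchange of two sums, legitimate because the double series is
    -- dominated by the total variations.
    have h1 : Summable fun p : ℕ × ℕ => μ p.1 (f p.2) := by
      refine Summable.of_norm ?_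
      have h2 : ∑' p : ℕ × ℕ, ‖μ p.1 (f p.2)‖ₑ ≠ ⊤ := by
        refine ne_top_of_le_ne_top (tsum_variation_univ_ne_top hμ) ?_
        rw [ENNReal.tsum_prod (f := fun n i => ‖μ n (f i)‖ₑ)]
        refine ENNReal.tsum_le_tsum fun n => ?_
        calc ∑' i, ‖μ n (f i)‖ₑ ≤ ∑' i, (μ n).variation (f i) :=
              ENNReal.tsum_le_tsum fun i => VectorMeasure.enorm_measure_le_variation _ _
          _ = (μ n).variation (⋃ i, f i) := (measure_iUnion hd hf).symm
          _ ≤ _ := measure_mono (Set.subset_univ _)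
      simp_rw [enorm_eq_nnnorm] at h2
      exact NNReal.summable_coe.mpr (ENNReal.tsum_coe_ne_top_iff_summable.mp h2)
    have h3 : ∀ n, HasSum (fun i => μ n (f i)) (μ n (⋃ i, f i)) := fun n =>
      (μ n).m_iUnion hf hd
    have h4 : HasSum (fun p : ℕ × ℕ => μ p.2 (f p.1)) (∑' n, μ n (⋃ i, f i)) := by
      have h5 := (h1.hasSum.prod_fiberwise h3).tsum_eq
      rw [h5]
      exact (Equiv.prodComm ℕ ℕ).hasSum_iff.mpr h1.hasSum
    exact h4.prod_fiberwise fun i => (h4.summable.prod_factor i).hasSum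

theorem hasSum_sumMeasure (μ : ℕ → SignedMeasure Θ) (hμ : Summable fun n => tvNorm (μ n))
    (s : Set Θ) : HasSum (fun n => μ n s) (sumMeasure μ hμ s) :=
  (Summable.of_norm_bounded hμ fun n => abs_apply_le_tvNorm (μ n) s).hasSum

/-- The sum of the variations is a measure dominating the limit set by set, and the variation is the
least such measure. -/
theorem tvNorm_sumMeasure_le (μ : ℕ → SignedMeasure Θ) (hμ : Summable fun n => tvNorm (μ n)) :
    tvNorm (sumMeasure μ hμ) ≤ ∑' n, tvNorm (μ n) := by
  have h1 : (sumMeasure μ hμ).variation ≤ Measure.sum fun n => (μ n).variation := by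
    refine VectorMeasure.variation_le_of_forall_enorm_le fun E hE => ?_
    rw [Measure.sum_apply _ hE]
    refine (enorm_tsum_le_tsum_enorm).trans ?_
    exact ENNReal.tsum_le_tsum fun n => VectorMeasure.enorm_measure_le_variation _ _
  have h2 := h1 Set.univ
  rw [Measure.sum_apply _ MeasurableSet.univ, ← ofReal_tvNorm] at h2
  simp_rw [← ofReal_tvNorm] at h2
  rw [← ENNReal.ofReal_tsum_of_nonneg (fun n => tvNorm_nonneg _) hμ] at h2
  exact (ENNReal.ofReal_le_ofReal_iff (tsum_nonneg fun n => tvNorm_nonneg _)).mp h2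

/-- The remainder is written as a `sumMeasure` again, so that `tvNorm_sumMeasure_le` bounds it by a
tail of the norm series. -/
theorem sumMeasure_eq_sum_add (μ : ℕ → SignedMeasure Θ) (hμ : Summable fun n => tvNorm (μ n))
    (N : ℕ) : sumMeasure μ hμ = ∑ n ∈ Finset.range N, μ n +
      sumMeasure (fun n => μ (n + N)) ((summable_nat_add_iff (f := fun n => tvNorm (μ n)) N).mpr hμ) := by
  refine VectorMeasure.ext fun s _ => ?_
  have h1 := (hasSum_nat_add_iff (f := fun n => μ n s) N).mp (hasSum_sumMeasure (fun n => μ (n + N))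
    ((summable_nat_add_iff (f := fun n => tvNorm (μ n)) N).mpr hμ) s)
  rw [(hasSum_sumMeasure μ hμ s).unique h1, add_apply, add_comm, FunLike.coe_sum,
    Finset.sum_apply]

theorem tvNorm_dirac (θ : Θ) : tvNorm (VectorMeasure.dirac θ (1 : ℝ)) = 1 := by
  simp [tvNorm, Measure.real]

variable [TopologicalSpace Θ] [BorelSpace Θ] {X : Type*} {n : ℕ} {Φ : X → Fin n → C₀(Θ, ℝ)}

namespace IntegralSpace

theorem exists_mk_tvNorm_lt (f : IntegralSpace Φ) {ε : ℝ} (hε : 0 < ε) :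
    ∃ μ, mk Φ μ = f ∧ tvNorm μ < ‖f‖ + ε := by
  by_contra! h
  exact (le_norm h).not_gt (lt_add_of_pos_right _ hε)

theorem mk_sum {ι : Type*} (s : Finset ι) (μ : ι → SignedMeasure Θ) :
    mk Φ (∑ i ∈ s, μ i) = ∑ i ∈ s, mk Φ (μ i) :=
  map_sum (LinearMap.rangeRestrict (integralMap Φ)) μ s

instance : CompleteSpace (IntegralSpace Φ) := by
  refine NormedAddCommGroup.completeSpace_of_summable_imp_tendsto fun u hu => ?_
  -- The infimum defining the norm need not be attained; the errors `(1/2)^n` keep the lifted norms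
  -- summable.
  choose μ hμu hμ using fun n => exists_mk_tvNorm_lt (u n) (pow_pos (one_half_pos (α := ℝ)) n)
  have hs : Summable fun n => tvNorm (μ n) :=
    (hu.add summable_geometric_two).of_nonneg_of_le (fun n => tvNorm_nonneg _) fun n => (hμ n).le
  refine ⟨mk Φ (sumMeasure μ hs), ?_⟩
  rw [tendsto_iff_norm_sub_tendsto_zero]
  refine squeeze_zero (fun _ => norm_nonneg _) (fun N => ?_)
    (tendsto_sum_nat_add fun n => tvNorm (μ n))
  rw [sumMeasure_eq_sum_add μ hs N, mk_add, mk_sum]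
  simp_rw [hμu]
  rw [sub_add_cancel_left, norm_neg]
  exact (norm_mk_le _).trans (tvNorm_sumMeasure_le _ _)

variable (Φ) in
theorem isVectorRKBS : IsVectorRKBS (toFun Φ) where
  complete := inferInstance
  injective := Subtype.val_injective
  bounded_eval x := by
    have h0 : 0 ≤ ∑ k, ‖Φ x k‖ := Finset.sum_nonneg fun k _ => norm_nonneg _
    -- The `+ 1` makes the constant strictly positive even if every `Φ x k` is zero.
    refine ⟨∑ k, ‖Φ x k‖ + 1, by positivity, fun f => ?_⟩
    refine (pi_norm_le_iff_of_nonneg (by positivity)).mpr fun k => ?_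
    refine (abs_toFun_le f x k).trans ?_
    gcongr
    have := Finset.single_le_sum (f := fun k => ‖Φ x k‖) (fun k _ => norm_nonneg _)
      (Finset.mem_univ k)
    linarith

end IntegralSpace

end Completeness

/-! ### The closed span of the generators. -/

section ClosedSpan

variable {Θ : Type*} [TopologicalSpace Θ] {X : Type*} {n : ℕ}

theorem mem_closedSpan (Φ : X → Fin n → C₀(Θ, ℝ)) (x : X) (k : Fin n) : Φ x k ∈ closedSpan Φ :=
  Submodule.le_topologicalClosure _ (Submodule.subset_span ⟨(x, k), rfl⟩)

theorem isClosed_closedSpan (Φ : X → Fin n → C₀(Θ, ℝ)) :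
    IsClosed (closedSpan Φ : Set C₀(Θ, ℝ)) :=
  Submodule.isClosed_topologicalClosure _

theorem closedSpanToFun_injective (Φ : X → Fin n → C₀(Θ, ℝ)) :
    Function.Injective (closedSpanToFun Φ) :=
  fun _ _ h => Subtype.ext (DFunLike.coe_injective h)

end ClosedSpan

/-! ### Identification of the closed span with the `δ`-dual space. -/

section Duality

variable {Θ : Type*} [MeasurableSpace Θ] [TopologicalSpace Θ] [BorelSpace Θ]

/-- Integration against a signed measure, as a continuous linear functional on `C₀(Θ)`. -/
def integralFunctional (μ : SignedMeasure Θ) : StrongDual ℝ C₀(Θ, ℝ) :=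
  LinearMap.mkContinuous
    { toFun := fun g => ∫ᵛ θ, g θ ∂•μ
      map_add' := fun f g =>
        VectorMeasure.integral_add (integrable_of_c0 μ f) (integrable_of_c0 μ g)
      map_smul' := fun c _ => VectorMeasure.integral_fun_smul _ _ c _ }
    (tvNorm μ) fun g => by
      rw [mul_comm]
      exact abs_integral_le μ g

theorem integral_dirac_one (g : C₀(Θ, ℝ)) (θ : Θ) :
    ∫ᵛ x, g x ∂•(VectorMeasure.dirac θ (1 : ℝ)) = g θ := by
  rw [VectorMeasure.integral_dirac' (f := g) g.continuous.stronglyMeasurable]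
  simp

variable {X : Type*} {n : ℕ} {Φ : X → Fin n → C₀(Θ, ℝ)}

/-- The difference of the two integration functionals is continuous and vanishes on the generators,
so its closed kernel contains their closed span. -/
theorem integral_eq_of_mk_eq {μ ν : SignedMeasure Θ}
    (h : IntegralSpace.mk Φ μ = IntegralSpace.mk Φ ν) (g : closedSpan Φ) :
    ∫ᵛ θ, g.1 θ ∂•μ = ∫ᵛ θ, g.1 θ ∂•ν := by
  have hle : closedSpan Φ ≤ (integralFunctional μ - integralFunctional ν).ker := by
    refine Submodule.topologicalClosure_minimal _ (Submodule.span_le.mpr ?_)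
      (integralFunctional μ - integralFunctional ν).isClosed_ker
    rintro _ ⟨⟨x, k⟩, rfl⟩
    exact sub_eq_zero.mpr (congrFun (congrFun (congrArg Subtype.val h) x) k)
  exact sub_eq_zero.mp (hle g.2)

/-- The functional `f_μ ↦ ∫ g dμ` for `g` in the closed span of the functions `Φ x k`. -/
def dualFunctional (g : closedSpan Φ) : StrongDual ℝ (IntegralSpace Φ) :=
  LinearMap.mkContinuous
    -- The chosen representing measure is immaterial by `integral_eq_of_mk_eq`, which is also what
    -- gives linearity.
    { toFun := fun f => ∫ᵛ θ, g.1 θ ∂•(IntegralSpace.exists_mk f).choose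
      map_add' := fun f₁ f₂ => by
        rw [← VectorMeasure.integral_add_vectorMeasure (integrable_of_c0 _ _)
          (integrable_of_c0 _ _)]
        refine integral_eq_of_mk_eq ?_ g
        rw [IntegralSpace.mk_add]
        simp only [(IntegralSpace.exists_mk _).choose_spec]
      map_smul' := fun c f => by
        rw [RingHom.id_apply, smul_eq_mul, ← smul_eq_mul,
          ← VectorMeasure.integral_smul_vectorMeasure]
        refine integral_eq_of_mk_eq ?_ g
        rw [IntegralSpace.mk_smul]
        simp only [(IntegralSpace.exists_mk _).choose_spec] }
    ‖g‖ fun f => by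
      refine le_of_forall_pos_le_add fun ε hε => ?_
      -- The slack is scaled so that multiplying it by `‖g‖` costs at most `ε`; the `+ 1` covers `g
      -- = 0`.
      obtain ⟨μ, hμ, hlt⟩ := IntegralSpace.exists_mk_tvNorm_lt f
        (div_pos hε (by positivity : 0 < ‖g‖ + 1))
      have h1 : ∫ᵛ θ, g.1 θ ∂•(IntegralSpace.exists_mk f).choose = ∫ᵛ θ, g.1 θ ∂•μ :=
        integral_eq_of_mk_eq ((IntegralSpace.exists_mk f).choose_spec.trans hμ.symm) g
      change |∫ᵛ θ, g.1 θ ∂•(IntegralSpace.exists_mk f).choose| ≤ _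
      rw [h1]
      calc _ ≤ ‖g‖ * tvNorm μ := abs_integral_le μ g.1
        _ ≤ ‖g‖ * (‖f‖ + ε / (‖g‖ + 1)) := by gcongr
        _ = ‖g‖ * ‖f‖ + ‖g‖ / (‖g‖ + 1) * ε := by ring
        _ ≤ ‖g‖ * ‖f‖ + 1 * ε := by
          gcongr
          exact div_le_one_of_le₀ (by linarith) (by positivity)
        _ = _ := by rw [one_mul]

theorem dualFunctional_mk (g : closedSpan Φ) (μ : SignedMeasure Θ) :
    dualFunctional g (IntegralSpace.mk Φ μ) = ∫ᵛ θ, g.1 θ ∂•μ :=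
  integral_eq_of_mk_eq (IntegralSpace.exists_mk _).choose_spec g

theorem norm_dualFunctional (g : closedSpan Φ) : ‖dualFunctional g‖ = ‖g‖ := by
  refine le_antisymm (LinearMap.mkContinuous_norm_le _ (norm_nonneg g) _) ?_
  refine (BoundedContinuousFunction.norm_le (f := g.1.toBCF) (norm_nonneg _)).mpr fun θ => ?_
  -- Testing on the function of a Dirac measure, of norm at most 1, gives the value `g θ`.
  have h1 := (dualFunctional g).le_opNorm (IntegralSpace.mk Φ (VectorMeasure.dirac θ 1))
  rw [dualFunctional_mk, integral_dirac_one] at h1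
  refine h1.trans (mul_le_of_le_one_right (norm_nonneg _) ?_)
  exact (IntegralSpace.norm_mk_le _).trans (tvNorm_dirac θ).le

/-- The isometric embedding of the closed span of the functions `Φ x k` into the dual space. -/
def dualEmbedding (Φ : X → Fin n → C₀(Θ, ℝ)) :
    closedSpan Φ →ₗᵢ[ℝ] StrongDual ℝ (IntegralSpace Φ) where
  toFun := dualFunctional
  map_add' g₁ g₂ := by
    ext f
    obtain ⟨μ, rfl⟩ := IntegralSpace.exists_mk f
    rw [add_apply]
    simp only [dualFunctional_mk]
    exact map_add (integralFunctional μ) g₁.1 g₂.1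
  map_smul' c g := by
    ext f
    obtain ⟨μ, rfl⟩ := IntegralSpace.exists_mk f
    rw [RingHom.id_apply, smul_apply]
    simp only [dualFunctional_mk]
    exact map_smul (integralFunctional μ) c g.1
  norm_map' := norm_dualFunctional

theorem dualEmbedding_mk (g : closedSpan Φ) (μ : SignedMeasure Θ) :
    dualEmbedding Φ g (IntegralSpace.mk Φ μ) = ∫ᵛ θ, g.1 θ ∂•μ :=
  dualFunctional_mk g μ

theorem dualEmbedding_section (x : X) (k : Fin n) (f : IntegralSpace Φ) :
    dualEmbedding Φ ⟨Φ x k, mem_closedSpan Φ x k⟩ f = IntegralSpace.toFun Φ f x k := by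
  obtain ⟨μ, rfl⟩ := IntegralSpace.exists_mk f
  exact dualEmbedding_mk _ μ

/-- Generators correspond to point evaluations, and both sides are closed: the range because the
span is complete and the embedding isometric. -/
theorem range_dualEmbedding (Φ : X → Fin n → C₀(Θ, ℝ)) :
    (dualEmbedding Φ).toLinearMap.range = deltaDual (IntegralSpace.toFun Φ) := by
  have : CompleteSpace (closedSpan Φ) := (isClosed_closedSpan Φ).completeSpace_coe
  refine le_antisymm ?_ (Submodule.topologicalClosure_minimal _ (Submodule.span_le.mpr ?_)
    (dualEmbedding Φ).isometry.isClosedEmbedding.isClosed_range)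
  · let D := (deltaDual (IntegralSpace.toFun Φ)).comap (dualEmbedding Φ).toLinearMap
    have hD : IsClosed (D : Set (closedSpan Φ)) :=
      (Submodule.isClosed_topologicalClosure _).preimage (dualEmbedding Φ).continuous
    -- The preimage `D` is closed in a closed subspace, so its image in `C₀(Θ)` is closed;
    -- containing the generators, it contains their whole closed span.
    have hle : closedSpan Φ ≤ D.map (closedSpan Φ).subtype := by
      refine Submodule.topologicalClosure_minimal _ (Submodule.span_le.mpr ?_)
        ((isClosed_closedSpan Φ).isClosedEmbedding_subtypeVal.isClosedMap _ hD)
      rintro _ ⟨⟨x, k⟩, rfl⟩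
      exact ⟨⟨Φ x k, mem_closedSpan Φ x k⟩, Submodule.le_topologicalClosure _
        (Submodule.subset_span ⟨x, k, dualEmbedding_section x k⟩), rfl⟩
    rintro _ ⟨g, rfl⟩
    obtain ⟨g', hg', h⟩ := hle g.2
    rwa [← Subtype.ext h]
  · rintro ℓ ⟨x, k, hℓ⟩
    exact ⟨⟨Φ x k, mem_closedSpan Φ x k⟩,
      ContinuousLinearMap.ext fun f => (dualEmbedding_section x k f).trans (hℓ f).symm⟩

/-- The isometric embedding of the closed span, with the `δ`-dual space as codomain. -/
def toDeltaDual (Φ : X → Fin n → C₀(Θ, ℝ)) :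
    closedSpan Φ →ₗᵢ[ℝ] deltaDual (IntegralSpace.toFun Φ) where
  toLinearMap := (dualEmbedding Φ).toLinearMap.codRestrict (deltaDual (IntegralSpace.toFun Φ))
    fun g => range_dualEmbedding Φ ▸ LinearMap.mem_range_self _ g
  norm_map' := (dualEmbedding Φ).norm_map

theorem toDeltaDual_surjective (Φ : X → Fin n → C₀(Θ, ℝ)) :
    Function.Surjective (toDeltaDual Φ) := by
  intro ℓ
  obtain ⟨g, hg⟩ := (range_dualEmbedding Φ).ge ℓ.2
  exact ⟨g, Subtype.ext hg⟩

/-- The isometric isomorphism of the `δ`-dual space with the closed span. -/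
def deltaDualEquiv (Φ : X → Fin n → C₀(Θ, ℝ)) :
    deltaDual (IntegralSpace.toFun Φ) ≃ₗᵢ[ℝ] closedSpan Φ :=
  -- Taking the inverse of the embedding makes `κ.symm` the embedding itself, so `dualForm` unfolds
  -- to integration by definition.
  LinearIsometryEquiv.symm
    { toLinearEquiv := LinearEquiv.ofBijective (toDeltaDual Φ).toLinearMap
        ⟨(toDeltaDual Φ).isometry.injective, toDeltaDual_surjective Φ⟩
      norm_map' := (toDeltaDual Φ).norm_map }

theorem isReproducingKernel_deltaDualEquiv (Φ : X → Fin n → C₀(Θ, ℝ)) :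
    IsReproducingKernel (IntegralSpace.toFun Φ) (closedSpan Φ) (closedSpanToFun Φ)
      (deltaDualEquiv Φ) fun x θ k => Φ x k θ where
  mem x k := ⟨⟨Φ x k, mem_closedSpan Φ x k⟩, rfl⟩
  reproducing x k g hg f := by
    obtain rfl : g = ⟨Φ x k, mem_closedSpan Φ x k⟩ := closedSpanToFun_injective Φ hg
    exact (dualEmbedding_section x k f).symm

end Duality

/-- The reproducing kernel with respect to a given isometric isomorphism is unique. -/
theorem IsReproducingKernel.unique {X X' : Type*} {n : ℕ} {B S : Type*} [NormedAddCommGroup B]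
    [NormedSpace ℝ B] [NormedAddCommGroup S] [NormedSpace ℝ S] {ev : B →ₗ[ℝ] (X → Fin n → ℝ)}
    {evS : S →ₗ[ℝ] (X' → ℝ)} {κ : deltaDual ev ≃ₗᵢ[ℝ] S} {K K' : X → X' → Fin n → ℝ}
    (hK : IsReproducingKernel ev S evS κ K) (hK' : IsReproducingKernel ev S evS κ K') :
    K = K' := by
  funext x θ k
  obtain ⟨g, hg⟩ := hK.mem x k
  obtain ⟨g', hg'⟩ := hK'.mem x k
  -- Both `κ.symm g` and `κ.symm g'` are evaluation at `x`, component `k`.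
  have h : g = g' := κ.symm.injective <| Subtype.ext <| ContinuousLinearMap.ext fun f =>
    (hK.reproducing x k g hg f).symm.trans (hK'.reproducing x k g' hg' f)
  exact congrFun (hg.symm.trans (h ▸ hg')) θ

end DeepRKBS

end

open DeepRKBS MeasureTheory in
theorem mainTheorem3 (L : ℕ) (m : ℕ → ℕ) (hm : ∀ j ≤ L + 1, 0 < m j)
    (σ : ℝ → ℝ) (hσ : Continuous σ)
    (ρ : ParamSpace L m → ℝ) (hρ : Continuous ρ) (hρ_pos : ∀ θ, 0 < ρ θ)
    (h : ∀ x k, MemC0 fun θ => netKernel σ ρ x θ k) :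
    IsVectorRKBS (IntegralSpace.toFun (netSection σ ρ h)) ∧
    ∃ κ : deltaDual (IntegralSpace.toFun (netSection σ ρ h)) ≃ₗᵢ[ℝ] closedSpan (netSection σ ρ h),
      (∀ (g : closedSpan (netSection σ ρ h)) (μ : SignedMeasure (ParamSpace L m)),
        dualForm κ g (IntegralSpace.mk (netSection σ ρ h) μ) = ∫ᵛ θ, g.1 θ ∂•μ) ∧
      IsReproducingKernel (IntegralSpace.toFun (netSection σ ρ h))
        (closedSpan (netSection σ ρ h)) (closedSpanToFun (netSection σ ρ h)) κ (netKernel σ ρ) ∧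
      ∀ K, IsReproducingKernel (IntegralSpace.toFun (netSection σ ρ h))
        (closedSpan (netSection σ ρ h)) (closedSpanToFun (netSection σ ρ h)) κ K → K = netKernel σ ρ := by

  exact ⟨IntegralSpace.isVectorRKBS _, deltaDualEquiv _,
    fun g μ => dualEmbedding_mk g μ, isReproducingKernel_deltaDualEquiv (netSection σ ρ h),
    fun K hK => hK.unique (isReproducingKernel_deltaDualEquiv (netSection σ ρ h))⟩
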